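/- Let $\mathcal V$ be a countably infinite set of variables. A signature is a set of function symbols with fixed arities; for a signature $\mathcal F$ let $\mathcal T(\mathcal F,\mathcal V)$ be the set of terms over $\mathcal F$ and $\mathcal V$, and for a set $X$ of function symbols let $\mathcal T_X(\mathcal F,\mathcal V)$ be the set of those terms in $\mathcal T(\mathcal F,\mathcal V)$ whose root symbol belongs to $X$. A term rewrite system (TRS) over $\mathcal F$ is a set $\mathcal R\subseteq\mathcal T(\mathcal F,\mathcal V)^2$ of rules $\ell\to r$ such that $\ell$ is not a variable and every variable of $r$ occurs in $\ell$; it is confluent if its rewrite relation $\to_{\mathcal R}$ on $\mathcal T(\mathcal F,\mathcal V)$ is confluent, that is, whenever $s\to_{\mathcal R}^* t$ and $s\to_{\mathcal R}^* u$ there is a term $v$ with $t\to_{\mathcal R}^* v$ and $u\to_{\mathcal R}^* v$. Theorem. Let $\mathcal R_1$ and $\mathcal R_2$ be TRSs over signatures $\mathcal F_1$ and $\mathcal F_2$, respectively (a symbol common to both has the same arity in both), and put $\mathcal B=\mathcal F_1\cap\mathcal F_2$, $\mathcal D_1=\mathcal F_1\setminus\mathcal F_2$, $\mathcal D_2=\mathcal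 F_2\setminus\mathcal F_1$. Suppose that $$\mathcal R_1\subseteq\mathcal T(\mathcal B,\mathcal V)^2\cup\mathcal T_{\mathcal D_1}(\mathcal F_1,\mathcal V)^2,\qquad \mathcal R_2\subseteq\mathcal T(\mathcal B,\mathcal V)^2\cup\mathcal T_{\mathcal D_2}(\mathcal F_2,\mathcal V)^2,$$ $$\mathcal R_1\cap\mathcal T(\mathcal B,\mathcal V)^2=\mathcal R_2\cap\mathcal T(\mathcal B,\mathcal V)^2.$$ If $\mathcal R_1$ and $\mathcal R_2$ are confluent, then the TRS $\mathcal R_1\cup\mathcal R_2$ over $\mathcal F_1\cup\mathcal F_2$ is confluent. -/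

import Mathlib

/-! First-order term rewriting. Terms are Mathlib's `FirstOrder.Language.Term`: the function symbols
of an ambient language `L` are the symbols available, each with its arity (relation symbols play no
role), and a signature is a set of these symbols. -/

namespace Rewriting

universe u v w

/-- A function symbol together with its arity. -/
abbrev FunSymbol (L : FirstOrder.Language.{u, v}) : Type u := Σ n : ℕ, L.Functions n

section Terms

variable {L : FirstOrder.Language.{u, v}} {V : Type w}

/-- The set of function symbols occurring in a term. -/
def funs : L.Term V → Set (FunSymbol L)
  | .var _ => ∅
  | .func (l := n) f ts => insert ⟨n, f⟩ (⋃ i, funs (ts i))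

/-- The set of variables occurring in a term. -/
def vars : L.Term V → Set V
  | .var x => {x}
  | .func _ ts => ⋃ i, vars (ts i)

/-- The root symbol of the term is a function symbol in `X`. -/
def HasRootIn (X : Set (FunSymbol L)) : L.Term V → Prop
  | .var _ => False
  | .func (l := n) f _ => ⟨n, f⟩ ∈ X

end Terms

/-- The set `T(F, V)` of terms over the signature `F` with variables in `V`. -/
def termsOver {L : FirstOrder.Language.{u, v}} (F : Set (FunSymbol L)) (V : Type w) :
    Set (L.Term V) :=
  {t | funs t ⊆ F}

/-- The set `T_X(F, V)` of terms over the signature `F` whose root symbol belongs to `X`. -/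
def rootedTermsOver {L : FirstOrder.Language.{u, v}} (X F : Set (FunSymbol L)) (V : Type w) :
    Set (L.Term V) :=
  {t | t ∈ termsOver F V ∧ HasRootIn X t}

/-- A term rewrite system: a signature and a set of rewrite rules over it. Left-hand sides of rules
are not variables, and every variable of a right-hand side occurs in the left-hand side. -/
structure TRS (L : FirstOrder.Language.{u, v}) (V : Type w) where
  sig : Set (FunSymbol L)
  rules : Set (L.Term V × L.Term V)
  rules_subset : rules ⊆ termsOver sig V ×ˢ termsOver sig V
  lhs_ne_var : ∀ ρ ∈ rules, ∀ x : V, ρ.1 ≠ FirstOrder.Language.Term.var x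
  vars_subset : ∀ ρ ∈ rules, vars ρ.2 ⊆ vars ρ.1

/-- Confluence of a relation: any two reducts (in any number of steps) of one element have a common
reduct. -/
def Confluent {α : Type*} (r : α → α → Prop) : Prop :=
  ∀ s t u : α, Relation.ReflTransGen r s t → Relation.ReflTransGen r s u →
    Relation.Join (Relation.ReflTransGen r) t u

namespace TRS

variable {L : FirstOrder.Language.{u, v}} {V : Type w}

/-- One rewrite step: an instance of the left-hand side of a rule, under a substitution into the
terms over the signature, is replaced by the same instance of the right-hand side, at the root or
below an argument position. -/
inductive Step (R : TRS L V) : L.Term V → L.Term V → Prop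
  | rule {l r : L.Term V} (h : (l, r) ∈ R.rules) (σ : V → L.Term V)
      (hσ : ∀ x, σ x ∈ termsOver R.sig V) : Step R (l.subst σ) (r.subst σ)
  | arg {n : ℕ} (f : L.Functions n) (ts : Fin n → L.Term V) (i : Fin n) (t' : L.Term V)
      (h : Step R (ts i) t') :
      Step R (.func f ts) (.func f (Function.update ts i t'))

/-- A TRS is confluent if its rewrite relation on the terms over its signature is confluent. -/
def IsConfluent (R : TRS L V) : Prop :=
  Confluent (fun s t : termsOver R.sig V => R.Step s t)

/-- The union of two TRSs, over the union of their signatures. -/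
def union (R₁ R₂ : TRS L V) : TRS L V where
  sig := R₁.sig ∪ R₂.sig
  rules := R₁.rules ∪ R₂.rules
  rules_subset := by
    rintro ρ (h | h)
    · exact ⟨(R₁.rules_subset h).1.trans Set.subset_union_left,
        (R₁.rules_subset h).2.trans Set.subset_union_left⟩
    · exact ⟨(R₂.rules_subset h).1.trans Set.subset_union_right,
        (R₂.rules_subset h).2.trans Set.subset_union_right⟩
  lhs_ne_var := by
    rintro ρ (h | h)
    · exact R₁.lhs_ne_var ρ h
    · exact R₂.lhs_ne_var ρ h
  vars_subset := by
    rintro ρ (h | h)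
    · exact R₁.vars_subset ρ h
    · exact R₂.vars_subset ρ h

end TRS

end Rewriting

/-! Fix a system `S` inside `R` such that every rule of `R` is a rule of `S` or has both root
symbols outside the signature of `S`. Split a term into its top layer over that signature and its
aliens, the maximal subterms rooted elsewhere. A step of `R` either is a step of `S` in the top
layer, which erases or copies aliens, or takes place inside an alien, which remains an alien.
If `R` is confluent at the aliens, replace joinable aliens by equal variables, all others by
different ones: steps inside aliens become invisible, and every reduction of `R` becomes one of `S`.
Two reducts of a term are thus joined by `S` up to the naming, and the join is lifted to `R` by
substituting for each variable a common reduct of the finitely many aliens it names. Induction on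
terms then gives confluence of `R` once every symbol lies in the signature of some such confluent
`S`; in the theorem, `S` is one of the two given systems. -/

namespace Rewriting

universe u v w w'

open FirstOrder.Language (Term)
open FirstOrder.Language.Term (var func)
open Relation (ReflTransGen Join equivalence_join reflTransGen_iff_eq)

section AbstractReduction

variable {α : Type*} {r : α → α → Prop}

/-- Confluence of `r` at the single element `s`: any two reducts of `s` have a common reduct. -/
def ConfluentAt (r : α → α → Prop) (s : α) : Prop :=
  ∀ t u : α, ReflTransGen r s t → ReflTransGen r s u → Join (ReflTransGen r) t u

/-- The set `S` is closed under reduction. -/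
def Closed (r : α → α → Prop) (S : Set α) : Prop :=
  ∀ ⦃a b⦄, r a b → a ∈ S → b ∈ S

theorem confluentAt_of_forall_not {s : α} (h : ∀ t, ¬ r s t) : ConfluentAt r s := by
  intro t u ht hu
  rw [(reflTransGen_iff_eq h).1 ht, (reflTransGen_iff_eq h).1 hu]
  exact ⟨s, .refl, .refl⟩

theorem closed_confluentAt : Closed r {s | ConfluentAt r s} :=
  fun _ _ hab ha t u ht hu => ha t u (ht.head hab) (hu.head hab)

namespace Closed

variable {S T : Set α}

theorem inter (hS : Closed r S) (hT : Closed r T) : Closed r (S ∩ T) :=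
  fun _ _ hab ha => ⟨hS hab ha.1, hT hab ha.2⟩

theorem mem_of_reflTransGen (hS : Closed r S) {a b : α} (hab : ReflTransGen r a b)
    (ha : a ∈ S) : b ∈ S := by
  induction hab with
  | refl => exact ha
  | tail _ h ih => exact hS h ih

theorem reflTransGen_subtype_iff (hS : Closed r S) {a b : S} :
    ReflTransGen (fun a b : S => r a b) a b ↔ ReflTransGen r (a : α) b := by
  refine ⟨fun h => h.lift Subtype.val fun _ _ => id, fun h => ?_⟩
  obtain ⟨b, hb⟩ := b
  dsimp only at h
  induction h with
  | refl => exact .refl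
  | tail h₁ h₂ ih => exact (ih (hS.mem_of_reflTransGen h₁ a.2)).tail h₂

theorem confluent_subtype_iff (hS : Closed r S) :
    Confluent (fun a b : S => r a b) ↔ ∀ a ∈ S, ConfluentAt r a := by
  constructor
  · intro h a ha b c hab hac
    obtain ⟨d, hbd, hcd⟩ := h ⟨a, ha⟩ ⟨b, hS.mem_of_reflTransGen hab ha⟩
      ⟨c, hS.mem_of_reflTransGen hac ha⟩ (hS.reflTransGen_subtype_iff.2 hab)
      (hS.reflTransGen_subtype_iff.2 hac)
    exact ⟨d, hS.reflTransGen_subtype_iff.1 hbd, hS.reflTransGen_subtype_iff.1 hcd⟩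
  · intro h a b c hab hac
    obtain ⟨d, hbd, hcd⟩ := h a a.2 b c (hS.reflTransGen_subtype_iff.1 hab)
      (hS.reflTransGen_subtype_iff.1 hac)
    exact ⟨⟨d, hS.mem_of_reflTransGen hbd b.2⟩, hS.reflTransGen_subtype_iff.2 hbd,
      hS.reflTransGen_subtype_iff.2 hcd⟩

end Closed

namespace Confluent

/-- Joinability, an equivalence relation because `r` is confluent. -/
def joinSetoid (h : Confluent r) : Setoid α :=
  ⟨Join (ReflTransGen r), equivalence_join h⟩

theorem exists_common_reduct (h : Confluent r) (x : Quotient h.joinSetoid) {I : Set α}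
    (hI : I.Finite) : ∃ c, ∀ a ∈ I, Quotient.mk h.joinSetoid a = x → ReflTransGen r a c := by
  let q : α → Quotient h.joinSetoid := Quotient.mk _
  have directed : Directed (ReflTransGen r) (Subtype.val : {a // q a = x} → α) := by
    rintro ⟨a, ha⟩ ⟨b, hb⟩
    obtain ⟨c, hac, hbc⟩ : Join (ReflTransGen r) a b := Quotient.exact (ha.trans hb.symm)
    have hca : q c = q a := Quotient.sound ⟨c, .refl, hac⟩
    exact ⟨⟨c, hca.trans ha⟩, hac, hbc⟩
  have : Nonempty {a // q a = x} := let ⟨a, ha⟩ := x.exists_rep; ⟨a, ha⟩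
  obtain ⟨c, hc⟩ := directed.finite_set_le (hI.preimage Subtype.val_injective.injOn)
  exact ⟨c, fun a ha hax => hc ⟨a, hax⟩ ha⟩

theorem exists_naming {β : Type*} [Infinite β] [Nonempty α] (h : Confluent r) {I : Set α}
    (hI : I.Finite) : ∃ (name : α → β) (value : β → α),
      (∀ a b, r a b → name a = name b) ∧ ∀ a ∈ I, ReflTransGen r a (value (name a)) := by
  let q : α → Quotient h.joinSetoid := Quotient.mk _
  have hcard : (q '' I).encard ≤ (Set.univ : Set β).encard := by simp
  obtain ⟨ν, -, hν⟩ := (hI.image q).exists_injOn_of_encard_le hcard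
  choose c hc using fun x => h.exists_common_reduct x hI
  have : Nonempty (Quotient h.joinSetoid) := Nonempty.map q ‹_›
  refine ⟨ν ∘ q, c ∘ Function.invFunOn ν (q '' I), fun a b hab => ?_, fun a ha => ?_⟩
  · exact congrArg ν (Quotient.sound ⟨b, .single hab, .refl⟩)
  · exact hc _ a ha (hν.leftInvOn_invFunOn (Set.mem_image_of_mem q ha)).symm

end Confluent

theorem Closed.exists_naming {β : Type*} [Infinite β] {S I : Set α} (hS : Closed r S)
    (hne : S.Nonempty) (hconf : ∀ a ∈ S, ConfluentAt r a) (hI : I.Finite) (hIS : I ⊆ S) :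
    ∃ (name : α → β) (value : β → α), (∀ a ∈ S, ∀ b, r a b → name a = name b) ∧
      (∀ y, value y ∈ S) ∧ ∀ a ∈ I, ReflTransGen r a (value (name a)) := by
  classical
  have := hne.to_subtype
  obtain ⟨name, value, hname, hvalue⟩ := (hS.confluent_subtype_iff.2 hconf).exists_naming (β := β)
    (hI.preimage Subtype.val_injective.injOn)
  let name' (a : α) : β := if ha : a ∈ S then name ⟨a, ha⟩ else Classical.arbitrary β
  have name'_eq {a : α} (ha : a ∈ S) : name' a = name ⟨a, ha⟩ := dif_pos ha
  refine ⟨name', fun y => value y, fun a ha b hab => ?_, fun y => (value y).2, fun a ha => ?_⟩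
  · rw [name'_eq ha, name'_eq (hS hab ha)]
    exact hname _ _ hab
  · rw [name'_eq (hIS ha)]
    exact hS.reflTransGen_subtype_iff.1 (hvalue ⟨a, hIS ha⟩ ha)

end AbstractReduction

section Terms

variable {L : FirstOrder.Language.{u, v}} {V : Type w} {W : Type w'} {F G : Set (FunSymbol L)}

theorem var_mem_termsOver (x : V) : (var x : L.Term V) ∈ termsOver F V := by
  simp [termsOver, funs]

theorem func_mem_termsOver {n : ℕ} {f : L.Functions n} {ts : Fin n → L.Term V} :
    func f ts ∈ termsOver F V ↔ ⟨n, f⟩ ∈ F ∧ ∀ i, ts i ∈ termsOver F V := by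
  simp [termsOver, funs, Set.insert_subset_iff]

theorem termsOver_mono (h : F ⊆ G) : termsOver F V ⊆ termsOver G V :=
  fun _ ht => ht.trans h

theorem subst_mem_termsOver {t : L.Term W} {σ : W → L.Term V} (ht : t ∈ termsOver F W)
    (hσ : ∀ x, σ x ∈ termsOver F V) : t.subst σ ∈ termsOver F V := by
  induction t with
  | var x => exact hσ x
  | func f ts ih =>
    rw [func_mem_termsOver] at ht
    exact func_mem_termsOver.2 ⟨ht.1, fun i => ih i (ht.2 i)⟩

theorem subst_subst {U : Type*} (t : L.Term U) (σ : U → L.Term W) (τ : W → L.Term V) :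
    (t.subst σ).subst τ = t.subst fun x => (σ x).subst τ := by
  induction t with
  | var x => rfl
  | func f ts ih => simp only [Term.subst, ih]

theorem vars_subst (t : L.Term W) (σ : W → L.Term V) :
    vars (t.subst σ) = ⋃ x ∈ vars t, vars (σ x) := by
  induction t with
  | var x => simp [vars]
  | func f ts ih => simp only [Term.subst, vars, Set.biUnion_iUnion, ih]

theorem finite_vars (t : L.Term V) : (vars t).Finite := by
  induction t with
  | var x => exact Set.finite_singleton x
  | func _ _ ih => exact Set.finite_iUnion ih

theorem HasRootIn.mono (h : F ⊆ G) {t : L.Term V} (ht : HasRootIn F t) : HasRootIn G t := by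
  cases t with
  | var x => exact ht
  | func f ts => exact h ht

theorem HasRootIn.subst {t : L.Term W} (ht : HasRootIn F t) (σ : W → L.Term V) :
    HasRootIn F (t.subst σ) := by
  cases t with
  | var x => exact ht.elim
  | func f ts => exact ht

end Terms

section TopLayer

variable {L : FirstOrder.Language.{u, v}} {V : Type w} {W : Type w'} {F : Set (FunSymbol L)}

open Classical in
/-- The top layer of a term over `F`: the maximal subterms that are variables or have a root symbol
outside `F` become variables, each labelled by the subterm it stands for. -/
noncomputable def topLayer (F : Set (FunSymbol L)) : L.Term V → L.Term (L.Term V)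
  | .var x => var (var x)
  | .func (l := n) f ts =>
      if ⟨n, f⟩ ∈ F then func f fun i => topLayer F (ts i) else var (func f ts)

/-- The aliens of a term: its maximal subterms that are variables or have a root symbol outside
`F`. Counting the variables among them makes the term a substitution instance of its top layer. -/
def aliens (F : Set (FunSymbol L)) (t : L.Term V) : Set (L.Term V) :=
  vars (topLayer F t)

theorem topLayer_func_of_mem {n : ℕ} {f : L.Functions n} (hf : ⟨n, f⟩ ∈ F)
    (ts : Fin n → L.Term V) : topLayer F (func f ts) = func f fun i => topLayer F (ts i) :=
  if_pos hf

theorem topLayer_of_hasRootIn_compl {t : L.Term V} (ht : HasRootIn Fᶜ t) :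
    topLayer F t = var t := by
  cases t with
  | var x => exact ht.elim
  | func f ts => exact if_neg ht

theorem topLayer_mem_termsOver (t : L.Term V) : topLayer F t ∈ termsOver F (L.Term V) := by
  induction t with
  | var x => exact var_mem_termsOver _
  | func f ts ih =>
    rw [topLayer]
    split_ifs with hf
    · exact func_mem_termsOver.2 ⟨hf, ih⟩
    · exact var_mem_termsOver _

theorem topLayer_subst {t : L.Term W} (ht : t ∈ termsOver F W) (σ : W → L.Term V) :
    topLayer F (t.subst σ) = t.subst fun x => topLayer F (σ x) := by
  induction t with
  | var x => rfl
  | func f ts ih =>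
    rw [func_mem_termsOver] at ht
    simp only [Term.subst, topLayer_func_of_mem ht.1, fun i => ih i (ht.2 i)]

theorem topLayer_subst_id (t : L.Term V) : (topLayer F t).subst id = t := by
  induction t with
  | var x => rfl
  | func f ts ih =>
    rw [topLayer]
    split_ifs
    · simp only [Term.subst, ih]
    · rfl

theorem aliens_func_of_mem {n : ℕ} {f : L.Functions n} (hf : ⟨n, f⟩ ∈ F)
    (ts : Fin n → L.Term V) : aliens F (func f ts) = ⋃ i, aliens F (ts i) := by
  simp only [aliens, topLayer_func_of_mem hf, vars]

theorem aliens_of_hasRootIn_compl {t : L.Term V} (ht : HasRootIn Fᶜ t) : aliens F t = {t} := by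
  simp only [aliens, topLayer_of_hasRootIn_compl ht, vars]

theorem finite_aliens (t : L.Term V) : (aliens F t).Finite :=
  finite_vars (topLayer F t)

theorem aliens_subst {t : L.Term W} (ht : t ∈ termsOver F W) (σ : W → L.Term V) :
    aliens F (t.subst σ) = ⋃ x ∈ vars t, aliens F (σ x) := by
  simp only [aliens, topLayer_subst ht, vars_subst]

end TopLayer

namespace TRS

variable {L : FirstOrder.Language.{u, v}} {V : Type w} {W : Type w'} {R S : TRS L V}
  {s t : L.Term V}

theorem closed_termsOver (R : TRS L V) : Closed R.Step (termsOver R.sig V) := by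
  intro s t h hs
  induction h with
  | rule h σ hσ => exact subst_mem_termsOver (R.rules_subset h).2 hσ
  | arg f ts i t' _ ih =>
    rw [func_mem_termsOver] at hs ⊢
    refine ⟨hs.1, fun j => ?_⟩
    rcases eq_or_ne j i with rfl | hj
    · simpa using ih (hs.2 j)
    · simpa [hj] using hs.2 j

theorem isConfluent_iff : R.IsConfluent ↔ ∀ s ∈ termsOver R.sig V, ConfluentAt R.Step s :=
  R.closed_termsOver.confluent_subtype_iff

theorem not_step_var (x : V) : ¬ R.Step (var x) t := by
  intro h
  generalize hs : (var x : L.Term V) = s at h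
  cases h with
  | @rule l r h σ _ =>
    cases l with
    | var y => exact R.lhs_ne_var _ h y rfl
    | func f ts => simp at hs
  | arg => simp at hs

theorem Step.subst (hsig : S.sig ⊆ R.sig) (hrules : S.rules ⊆ R.rules) {τ : V → L.Term V}
    (hτ : ∀ x, τ x ∈ termsOver R.sig V) (h : S.Step s t) : R.Step (s.subst τ) (t.subst τ) := by
  induction h with
  | rule h σ hσ =>
    rw [subst_subst, subst_subst]
    exact .rule (hrules h) _ fun x => subst_mem_termsOver (termsOver_mono hsig (hσ x)) hτ
  | arg f ts i t' _ ih =>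
    have subst_update : (func f (Function.update ts i t')).subst τ =
        func f (Function.update (fun j => (ts j).subst τ) i (t'.subst τ)) :=
      congrArg (func f) (funext (Function.apply_update (fun _ t => t.subst τ) ts i t'))
    rw [subst_update]
    exact .arg f _ i _ ih

theorem reduces_update {n : ℕ} (f : L.Functions n) (ts : Fin n → L.Term V) (i : Fin n)
    (h : ReflTransGen R.Step (ts i) t) :
    ReflTransGen R.Step (func f ts) (func f (Function.update ts i t)) := by
  induction h with
  | refl => rw [Function.update_eq_self]
  | @tail b c _ h ih =>
    have step := Step.arg f (Function.update ts i b) i c (by simpa using h)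
    exact ih.tail (by simpa using step)

theorem reduces_func {n : ℕ} (f : L.Functions n) {ts us : Fin n → L.Term V}
    (h : ∀ i, ReflTransGen R.Step (ts i) (us i)) :
    ReflTransGen R.Step (func f ts) (func f us) := by
  classical
  have reduces_piecewise (I : Finset (Fin n)) :
      ReflTransGen R.Step (func f ts) (func f (I.piecewise us ts)) := by
    induction I using Finset.induction_on with
    | empty => simpa using ReflTransGen.refl
    | insert i I hi ih =>
      rw [Finset.piecewise_insert]
      exact ih.trans (reduces_update f _ i (by simpa [hi] using h i))
  simpa using reduces_piecewise Finset.univ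

theorem reduces_subst {σ τ : W → L.Term V} (t : L.Term W)
    (h : ∀ x ∈ vars t, ReflTransGen R.Step (σ x) (τ x)) :
    ReflTransGen R.Step (t.subst σ) (t.subst τ) := by
  induction t with
  | var x => exact h x rfl
  | func f ts ih => exact reduces_func f fun i => ih i fun x hx => h x (Set.mem_iUnion.2 ⟨i, hx⟩)

theorem reduces_topLayer_subst {F : Set (FunSymbol L)} {τ : L.Term V → L.Term V}
    (h : ∀ a ∈ aliens F t, ReflTransGen R.Step a (τ a)) :
    ReflTransGen R.Step t ((topLayer F t).subst τ) := by
  simpa only [topLayer_subst_id] using reduces_subst (σ := id) (topLayer F t) h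

/-- The system `S` is a layer of `R`: it is contained in `R`, and every rule of `R` outside `S` has
both root symbols outside the signature of `S`. -/
structure IsLayer (S R : TRS L V) : Prop where
  sig_subset : S.sig ⊆ R.sig
  rules_subset : S.rules ⊆ R.rules
  rule_cases : ∀ ρ ∈ R.rules, ρ ∈ S.rules ∨ HasRootIn S.sigᶜ ρ.1 ∧ HasRootIn S.sigᶜ ρ.2

namespace IsLayer

theorem reduces_subst_of_reduces (hS : S.IsLayer R) {τ : V → L.Term V}
    (hτ : ∀ x, τ x ∈ termsOver R.sig V) (h : ReflTransGen S.Step s t) :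
    ReflTransGen R.Step (s.subst τ) (t.subst τ) :=
  h.lift (Term.subst · τ) fun _ _ => Step.subst hS.sig_subset hS.rules_subset hτ

theorem step_induction (hS : S.IsLayer R) {motive : ∀ s t, R.Step s t → Prop}
    (rule : ∀ l r, (l, r) ∈ S.rules → ∀ (σ : V → L.Term V) (h : R.Step (l.subst σ) (r.subst σ)),
      motive _ _ h)
    (alien : ∀ s t (h : R.Step s t), HasRootIn S.sigᶜ s → HasRootIn S.sigᶜ t → motive s t h)
    (arg : ∀ {n : ℕ} (f : L.Functions n) (ts : Fin n → L.Term V) (i : Fin n) (t' : L.Term V)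
      (h : R.Step (ts i) t'), ⟨n, f⟩ ∈ S.sig → motive _ _ h → motive _ _ (.arg f ts i t' h))
    {s t : L.Term V} (h : R.Step s t) : motive s t h := by
  induction h with
  | @rule l r h σ hσ =>
    rcases hS.rule_cases _ h with hρ | ⟨hl, hr⟩
    · exact rule l r hρ σ _
    · exact alien _ _ (.rule h σ hσ) (hl.subst σ) (hr.subst σ)
  | @arg n f ts i t' h ih =>
    by_cases hf : ⟨n, f⟩ ∈ S.sig
    · exact arg f ts i t' h hf ih
    · exact alien _ _ (.arg f ts i t' h) hf hf

theorem closed_aliens_subset (hS : S.IsLayer R) {C : Set (L.Term V)}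
    (hC : Closed R.Step C) : Closed R.Step {t | aliens S.sig t ⊆ C} := by
  intro s t h
  rw [Set.mem_ofPred_eq, Set.mem_ofPred_eq]
  induction h using hS.step_induction with
  | rule l r h σ _ =>
    rw [aliens_subst (S.rules_subset h).1, aliens_subst (S.rules_subset h).2]
    exact (Set.biUnion_mono (S.vars_subset _ h) fun _ _ => subset_rfl).trans
  | alien s t h hs ht =>
    rw [aliens_of_hasRootIn_compl hs, aliens_of_hasRootIn_compl ht, Set.singleton_subset_iff,
      Set.singleton_subset_iff]
    exact hC h
  | arg f ts i t' _ hf ih =>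
    rw [aliens_func_of_mem hf, aliens_func_of_mem hf, Set.iUnion_subset_iff, Set.iUnion_subset_iff]
    intro hts j
    rcases eq_or_ne j i with rfl | hj
    · simpa using ih (hts j)
    · simpa [hj] using hts j

theorem topLayer_subst_reduces_of_step (hS : S.IsLayer R) {τ : L.Term V → L.Term V}
    (hτ : ∀ a, τ a ∈ termsOver S.sig V) (h : R.Step s t)
    (hst : ∀ a ∈ aliens S.sig s, ∀ b, R.Step a b → ReflTransGen S.Step (τ a) (τ b)) :
    ReflTransGen S.Step ((topLayer S.sig s).subst τ) ((topLayer S.sig t).subst τ) := by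
  induction h using hS.step_induction with
  | rule l r h σ _ =>
    rw [topLayer_subst (S.rules_subset h).1, topLayer_subst (S.rules_subset h).2, subst_subst,
      subst_subst]
    exact .single (.rule h _ fun x => subst_mem_termsOver (topLayer_mem_termsOver _) hτ)
  | alien s t h hs ht =>
    rw [topLayer_of_hasRootIn_compl hs, topLayer_of_hasRootIn_compl ht]
    exact hst s (by simp [aliens_of_hasRootIn_compl hs]) t h
  | arg f ts i t' _ hf ih =>
    rw [aliens_func_of_mem hf] at hst
    rw [topLayer_func_of_mem hf, topLayer_func_of_mem hf]
    refine reduces_func f fun j => ?_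
    rcases eq_or_ne j i with rfl | hj
    · simpa using ih fun a ha => hst a (Set.mem_iUnion.2 ⟨j, ha⟩)
    · simpa [hj] using ReflTransGen.refl

theorem topLayer_subst_reduces (hS : S.IsLayer R) {τ : L.Term V → L.Term V}
    (hτ : ∀ a, τ a ∈ termsOver S.sig V) {C : Set (L.Term V)} (hC : Closed R.Step C)
    (hτC : ∀ a ∈ C, ∀ b, R.Step a b → ReflTransGen S.Step (τ a) (τ b))
    (hs : aliens S.sig s ⊆ C) (h : ReflTransGen R.Step s t) :
    ReflTransGen S.Step ((topLayer S.sig s).subst τ) ((topLayer S.sig t).subst τ) := by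
  induction h with
  | refl => exact .refl
  | tail hsb hbc ih =>
    have hb := (hS.closed_aliens_subset hC).mem_of_reflTransGen hsb hs
    exact ih.trans (hS.topLayer_subst_reduces_of_step hτ hbc fun a ha => hτC a (hb ha))

end IsLayer

/-- The terms over the signature at which the rewrite relation is confluent. -/
def confluentTerms (R : TRS L V) : Set (L.Term V) :=
  termsOver R.sig V ∩ {t | ConfluentAt R.Step t}

theorem closed_confluentTerms (R : TRS L V) : Closed R.Step R.confluentTerms :=
  R.closed_termsOver.inter closed_confluentAt

theorem var_mem_confluentTerms (x : V) : var x ∈ R.confluentTerms :=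
  ⟨var_mem_termsOver x, confluentAt_of_forall_not fun _ => not_step_var x⟩

theorem IsLayer.confluentAt [Infinite V] (hS : S.IsLayer R) (hconf : S.IsConfluent)
    (hs : aliens S.sig s ⊆ R.confluentTerms) : ConfluentAt R.Step s := by
  intro t u hst hsu
  have aliens_subset {t} : ReflTransGen R.Step s t → aliens S.sig t ⊆ R.confluentTerms := fun h =>
    (hS.closed_aliens_subset R.closed_confluentTerms).mem_of_reflTransGen h hs
  obtain ⟨name, value, name_eq, value_mem, reduces_value⟩ :=
    R.closed_confluentTerms.exists_naming (β := V)
      ⟨_, var_mem_confluentTerms (Classical.arbitrary V)⟩ (fun _ ha => ha.2)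
      ((finite_aliens t).union (finite_aliens u))
      (Set.union_subset (aliens_subset hst) (aliens_subset hsu))
  let named (t : L.Term V) : L.Term V := (topLayer S.sig t).subst fun a => var (name a)
  have named_reduces {t} : ReflTransGen R.Step s t → ReflTransGen S.Step (named s) (named t) :=
    hS.topLayer_subst_reduces (fun a => var_mem_termsOver (name a)) R.closed_confluentTerms
      (fun a ha b hab => by rw [name_eq a ha b hab]) hs
  obtain ⟨k, htk, huk⟩ := isConfluent_iff.1 hconf (named s)
    (subst_mem_termsOver (topLayer_mem_termsOver s) fun a => var_mem_termsOver (name a))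
    _ _ (named_reduces hst) (named_reduces hsu)
  have reduces_join {t} (ht : ∀ a ∈ aliens S.sig t, ReflTransGen R.Step a (value (name a)))
      (htk : ReflTransGen S.Step (named t) k) : ReflTransGen R.Step t (k.subst value) := by
    refine ReflTransGen.trans ?_ (hS.reduces_subst_of_reduces (fun y => (value_mem y).1) htk)
    rw [subst_subst]
    exact reduces_topLayer_subst ht
  exact ⟨k.subst value, reduces_join (fun a ha => reduces_value a (.inl ha)) htk,
    reduces_join (fun a ha => reduces_value a (.inr ha)) huk⟩

theorem union_comm (R S : TRS L V) : R.union S = S.union R := by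
  simp only [union, Set.union_comm]

section Union

variable {B D : Set (FunSymbol L)}

theorem isLayer_union_left (hD : D ⊆ R.sigᶜ)
    (hrules : S.rules ⊆ termsOver B V ×ˢ termsOver B V ∪
      rootedTermsOver D S.sig V ×ˢ rootedTermsOver D S.sig V)
    (hshared : S.rules ∩ termsOver B V ×ˢ termsOver B V ⊆ R.rules) :
    R.IsLayer (R.union S) where
  sig_subset := Set.subset_union_left
  rules_subset := Set.subset_union_left
  rule_cases _ hρ := hρ.elim .inl fun hρ => (hrules hρ).imp (fun hB => hshared ⟨hρ, hB⟩)
    fun ⟨hl, hr⟩ => ⟨hl.2.mono hD, hr.2.mono hD⟩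

theorem isLayer_union_right (hD : D ⊆ S.sigᶜ)
    (hrules : R.rules ⊆ termsOver B V ×ˢ termsOver B V ∪
      rootedTermsOver D R.sig V ×ˢ rootedTermsOver D R.sig V)
    (hshared : R.rules ∩ termsOver B V ×ˢ termsOver B V ⊆ S.rules) :
    S.IsLayer (R.union S) :=
  union_comm S R ▸ isLayer_union_left hD hrules hshared

end Union

end TRS

end Rewriting

open Rewriting in
theorem mainTheorem7_general {L : FirstOrder.Language} {V : Type*} [Infinite V]
    {R : TRS L V} (hlayers : ∀ f ∈ R.sig, ∃ S : TRS L V, f ∈ S.sig ∧ S.IsLayer R ∧ S.IsConfluent) :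
    R.IsConfluent := by
  suffices confluent_and_aliens : ∀ t ∈ termsOver R.sig V,
      t ∈ R.confluentTerms ∧ ∀ F, aliens F t ⊆ R.confluentTerms from
    TRS.isConfluent_iff.2 fun t ht => (confluent_and_aliens t ht).1.2
  intro t ht
  induction t with
  | var x =>
    have hx := TRS.var_mem_confluentTerms (R := R) x
    exact ⟨hx, fun _ => Set.singleton_subset_iff.2 hx⟩
  | @func n f ts ih =>
    obtain ⟨hf, hts⟩ := func_mem_termsOver.1 ht
    have aliens_subset {F} (hfF : ⟨n, f⟩ ∈ F) : aliens F (.func f ts) ⊆ R.confluentTerms := by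
      rw [aliens_func_of_mem hfF]
      exact Set.iUnion_subset fun i => (ih i (hts i)).2 F
    have hconf : .func f ts ∈ R.confluentTerms := by
      obtain ⟨S, hfS, hS, hconf⟩ := hlayers _ hf
      exact ⟨ht, hS.confluentAt hconf (aliens_subset hfS)⟩
    refine ⟨hconf, fun F => ?_⟩
    by_cases hfF : ⟨n, f⟩ ∈ F
    · exact aliens_subset hfF
    · rwa [aliens_of_hasRootIn_compl (t := .func f ts) hfF, Set.singleton_subset_iff]

theorem mainTheorem7 {L : FirstOrder.Language} {V : Type*} [Countable V] [Infinite V]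
    (R₁ R₂ : Rewriting.TRS L V) (B D₁ D₂ : Set (Rewriting.FunSymbol L))
    (hB : B = R₁.sig ∩ R₂.sig) (hD₁ : D₁ = R₁.sig \ R₂.sig) (hD₂ : D₂ = R₂.sig \ R₁.sig)
    (h₁ : R₁.rules ⊆
      Rewriting.termsOver B V ×ˢ Rewriting.termsOver B V ∪
        Rewriting.rootedTermsOver D₁ R₁.sig V ×ˢ Rewriting.rootedTermsOver D₁ R₁.sig V)
    (h₂ : R₂.rules ⊆
      Rewriting.termsOver B V ×ˢ Rewriting.termsOver B V ∪
        Rewriting.rootedTermsOver D₂ R₂.sig V ×ˢ Rewriting.rootedTermsOver D₂ R₂.sig V)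
    (hshared : R₁.rules ∩ Rewriting.termsOver B V ×ˢ Rewriting.termsOver B V =
      R₂.rules ∩ Rewriting.termsOver B V ×ˢ Rewriting.termsOver B V)
    (hconf₁ : R₁.IsConfluent) (hconf₂ : R₂.IsConfluent) :
    (R₁.union R₂).IsConfluent := by
  subst hB hD₁ hD₂
  have layer₁ : R₁.IsLayer (R₁.union R₂) :=
    Rewriting.TRS.isLayer_union_left (fun _ hf => hf.2) h₂ (hshared ▸ Set.inter_subset_left)
  have layer₂ : R₂.IsLayer (R₁.union R₂) :=
    Rewriting.TRS.isLayer_union_right (fun _ hf => hf.2) h₁ (hshared ▸ Set.inter_subset_left)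
  exact mainTheorem7_general fun f hf =>
    hf.elim (fun hf₁ => ⟨R₁, hf₁, layer₁, hconf₁⟩) fun hf₂ => ⟨R₂, hf₂, layer₂, hconf₂⟩
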